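/- Let $\mathbb{H}$ be the real quaternions, let $n\in\mathbb{N}$ and let $A\in M_n(\mathbb{H})$ be an $n\times n$ quaternionic matrix. Equip $\mathbb{H}^n$ with $\langle X,Y\rangle=\sum_{l=1}^n \overline{x_l}\,y_l$ and $\|X\|=\langle X,X\rangle^{1/2}$, and let $$W_{\mathbb{H}}(A)=\{\langle X,AX\rangle : X\in\mathbb{H}^n,\ \|X\|=1\}$$ be the quaternionic numerical range of $A$. Then for every imaginary unit $m$, i.e. $m\in\mathbb{H}$ with $\overline{m}=-m$ and $|m|=1$, the section $$W_{\mathbb{H}}(A)\cap\{\alpha+m\beta : \alpha,\beta\in\mathbb{R},\ \beta\ge 0\}$$ is a convex subset of the real vector space $\mathbb{H}$, and so is the section $W_{\mathbb{H}}(A)\cap\{\alpha+m\beta : \alpha,\beta\in\mathbb{R},\ \beta> 0\}$ by the open upper half plane. In particular, identifying $\alpha+i\beta\in\mathbb{C}$ with $\alpha+\beta i\in\mathbb{H}$, the complex section $W_{\mathbb{H}}(A)\cap\{z\in\mathbb{C} : \operatorname{Im} z\ge 0\}$ is a convex subset of $\mathbb{C}$. -/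

import Mathlib

open scoped Quaternion

namespace QuatRange

/-- The inner product `⟨p, q⟩ = ∑ l, conj (p l) * q l` on the right quaternionic space `ℍⁿ`,
conjugate linear in the first and linear in the second variable. -/
noncomputable def quatInner {n : ℕ} (p q : Fin n → ℍ) : ℍ := ∑ l, star (p l) * q l

/-- The norm of `EuclideanSpace ℍ (Fin n)` is the one induced by `quatInner`. -/
theorem quatInner_self {n : ℕ} (X : EuclideanSpace ℍ (Fin n)) :
    quatInner X.ofLp X.ofLp = ((‖X‖ ^ 2 : ℝ) : ℍ) := by
  rw [PiLp.norm_sq_eq_of_L2, quatInner]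
  refine Eq.trans (Finset.sum_congr rfl fun l _ => ?_)
    (map_sum (algebraMap ℝ ℍ) (fun l => ‖X.ofLp l‖ ^ 2) Finset.univ).symm
  rw [Quaternion.star_mul_self, Quaternion.normSq_eq_norm_mul_self, sq]
  rfl

/-- The quaternionic numerical range `{⟨X, A X⟩ : X ∈ ℍⁿ, ‖X‖ = 1}`. -/
def numericalRange {n : ℕ} (A : Matrix (Fin n) (Fin n) ℍ) : Set ℍ :=
  {q | ∃ X : EuclideanSpace ℍ (Fin n), ‖X‖ = 1 ∧ q = quatInner X.ofLp (A.mulVec X.ofLp)}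

/-- The imaginary unit quaternions. -/
def imaginaryUnits : Set ℍ := {q | star q = -q ∧ ‖q‖ = 1}

/-- The closed upper half plane `{α + m β : α, β ∈ ℝ, β ≥ 0}` of the slice `ℂ_m`. -/
def closedUpperSlice (m : ℍ) : Set ℍ :=
  {q | ∃ α β : ℝ, 0 ≤ β ∧ q = (α : ℍ) + m * (β : ℍ)}

/-- The open upper half plane `{α + m β : α, β ∈ ℝ, β > 0}` of the slice `ℂ_m`. -/
def openUpperSlice (m : ℍ) : Set ℍ :=
  {q | ∃ α β : ℝ, 0 < β ∧ q = (α : ℍ) + m * (β : ℍ)}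

/-- The complex section: the intersection of the numerical range with the closed upper half plane
of `ℂ`, as a subset of `ℂ`, where `ℂ ⊆ ℍ` through `a + b i ↦ a + b i + 0 j + 0 k`. -/
def complexSection {n : ℕ} (A : Matrix (Fin n) (Fin n) ℍ) : Set ℂ :=
  {z | (z : ℍ) ∈ numericalRange A ∧ 0 ≤ z.im}

end QuatRange

/-!
The numerical range is invariant under `q ↦ star u * q * u` for unit quaternions `u`, and two
quaternions are related in this way exactly when their real parts and the norms of their imaginary
parts agree (`exists_conj_eq`). Hence every section by an upper half slice is a copy of the planar
set `bild A` of the pairs `(q.re, ‖q.im‖)` with `q` in the numerical range, or of its part off the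
real axis, and it suffices to show that `bild A` is convex (`convex_bild`).

Two points of `bild A` come from two unit vectors, whose right span has dimension at most two, so
`A` may be replaced by a `2 × 2` compression. The skew-Hermitian part of a `2 × 2` matrix is
unitarily diagonalisable with entries `α i`, `β i`, where `α, β ≥ 0` (`exists_normalForm`). For a
unit vector `(x, y)` put `ξ = ‖x‖ ^ 2`, `υ = ‖y‖ ^ 2` and `w = y * star x`. Then `‖w‖ ^ 2 = ξ * υ`,
the real part of the value of the form is linear in `(ξ, υ, w)`, and with `w = c + d`, where `c` is
in the plane `⟨1, i⟩` and `d` in the plane `⟨j, k⟩`, the norm `b` of the imaginary part satisfies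
`b ^ 2 = (α ξ - β υ) ^ 2 + 4 α β ‖c‖ ^ 2 = (α ξ + β υ) ^ 2 - 4 α β ‖d‖ ^ 2`.
The first expression makes `b` a convex function of `(ξ, υ, c)`, the second a concave function of `(ξ, υ, d)`. A convex
combination of two triples `(ξ, υ, w)` satisfies only `‖w‖ ^ 2 ≤ ξ * υ`, but `c` and `d` can each be
lengthened within their planes without changing the real part of the value; by convexity and
concavity, this can be done so that `‖w‖ ^ 2 = ξ * υ` holds again and `b` takes exactly the wanted
value (`exists_interpolating_quaternion`).

The scalars act on `ℍⁿ` from the right; the vector `X p` is written `op p • X`.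
-/

namespace QuatRange

open Matrix MulOpposite

/-! ### Quaternions and conjugation -/

theorem norm_sq_eq_sum (w : ℍ) :
    ‖w‖ ^ 2 = w.re ^ 2 + w.imI ^ 2 + w.imJ ^ 2 + w.imK ^ 2 := by
  rw [sq, ← Quaternion.normSq_eq_norm_mul_self, Quaternion.normSq_def']

theorem star_mul_self_eq_one {u : ℍ} (hu : ‖u‖ = 1) : star u * u = 1 := by
  rw [Quaternion.star_mul_self, Quaternion.normSq_eq_norm_mul_self, hu]; simp

theorem norm_coeComplex_I : ‖((Complex.I : ℂ) : ℍ)‖ = 1 := by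
  rw [← pow_eq_one_iff_of_nonneg (norm_nonneg _) two_ne_zero, norm_sq_eq_sum]
  simp

theorem re_coe_add (r : ℝ) {v : ℍ} (hv : v.re = 0) : ((r : ℍ) + v).re = r := by
  simp [hv]

theorem im_coe_add (r : ℝ) {v : ℍ} (hv : v.re = 0) : ((r : ℍ) + v).im = v := by
  ext <;> simp [hv]

theorem norm_im_sq (q : ℍ) : ‖q.im‖ ^ 2 = ‖q‖ ^ 2 - q.re ^ 2 := by
  rw [norm_sq_eq_sum, norm_sq_eq_sum]; simp; ring

/-- Purely imaginary quaternions of equal norm are conjugate. For every `v`, the quaternion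
`p * v + v * q` intertwines `p` and `q`, because `p ^ 2 = q ^ 2` is real; some `v` makes it
nonzero. -/
theorem exists_norm_one_mul_eq_mul {p q : ℍ} (hp : p.re = 0) (hq : q.re = 0) (h : ‖p‖ = ‖q‖) :
    ∃ u : ℍ, ‖u‖ = 1 ∧ p * u = u * q := by
  by_cases h0 : p = 0
  · refine ⟨1, norm_one, ?_⟩
    have : q = 0 := by rw [← norm_eq_zero, ← h, h0, norm_zero]
    rw [h0, this]; simp
  have e : ∀ r : ℍ, r.re = 0 → r * r = ((-‖r‖ ^ 2 : ℝ) : ℍ) := by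
    intro r hr
    have : star r = -r := by ext <;> simp [hr]
    have h2 := Quaternion.self_mul_star r
    rw [this, Quaternion.normSq_eq_norm_mul_self, mul_neg] at h2
    rw [neg_eq_iff_eq_neg.1 h2, sq]; simp
  suffices H : ∃ v : ℍ, p * v + v * q ≠ 0 by
    obtain ⟨v, hv⟩ := H
    refine ⟨(‖p * v + v * q‖⁻¹ : ℝ) • (p * v + v * q), norm_smul_inv_norm (𝕜 := ℝ) hv, ?_⟩
    rw [mul_smul_comm, smul_mul_assoc, mul_add, add_mul, ← mul_assoc, e p hp, mul_assoc v q q,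
      e q hq, h, Quaternion.coe_commutes, mul_assoc p v q, add_comm (v * _)]
  -- If all these intertwiners vanish, then `q = -p` and `p` commutes with `i` and `j`, so the
  -- imaginary quaternion `p` is real, that is, zero.
  by_contra! H
  have hqp : q = -p := by
    have := H 1
    rw [mul_one, one_mul] at this
    exact (neg_eq_of_add_eq_zero_right this).symm
  obtain ⟨J, hJ0, hJ1, hJ2, hJ3⟩ : ∃ J : ℍ, J.re = 0 ∧ J.imI = 0 ∧ J.imJ = 1 ∧ J.imK = 0 :=
    ⟨⟨0, 0, 1, 0⟩, rfl, rfl, rfl, rfl⟩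
  have eI := H (Complex.I : ℂ)
  have eJ := H J
  rw [hqp] at eI eJ
  have eI2 := congrArg QuaternionAlgebra.imJ eI
  have eI3 := congrArg QuaternionAlgebra.imK eI
  have eJ3 := congrArg QuaternionAlgebra.imK eJ
  simp only [Quaternion.imJ_add, Quaternion.imK_add, Quaternion.imJ_mul, Quaternion.imK_mul,
    Quaternion.imI_neg, Quaternion.imJ_neg, Quaternion.imK_neg, Quaternion.re_neg,
    Quaternion.re_coeComplex, Quaternion.imI_coeComplex, Quaternion.imJ_coeComplex,
    Quaternion.imK_coeComplex, Complex.I_re, Complex.I_im, hJ0, hJ1, hJ2, hJ3,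
    Quaternion.imJ_zero, Quaternion.imK_zero] at eI2 eI3 eJ3
  refine h0 (Quaternion.ext _ _ hp ?_ ?_ ?_) <;> simp <;> linarith

theorem exists_conj_eq {p q : ℍ} (hre : p.re = q.re) (him : ‖p.im‖ = ‖q.im‖) :
    ∃ u : ℍ, ‖u‖ = 1 ∧ star u * p * u = q := by
  obtain ⟨u, hu, h⟩ := exists_norm_one_mul_eq_mul (Quaternion.re_im p) (Quaternion.re_im q) him
  refine ⟨u, hu, ?_⟩
  rw [← Quaternion.re_add_im p, ← Quaternion.re_add_im q, mul_assoc, add_mul, h, hre,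
    Quaternion.coe_commutes, ← mul_add, ← mul_assoc, star_mul_self_eq_one hu, one_mul]

/-- The imaginary part of the value of a normal form at `(x, y)`; besides `‖x‖` and `‖y‖`,
its norm involves only the component of `y * star x` in the plane `⟨1, i⟩`. -/
theorem norm_sq_star_mul_I_mul_add (α β : ℝ) (x y : ℍ) :
    ‖star x * (α • ((Complex.I : ℂ) : ℍ)) * x + star y * (β • ((Complex.I : ℂ) : ℍ)) * y‖ ^ 2 =
      (α * ‖x‖ ^ 2 - β * ‖y‖ ^ 2) ^ 2 +
        4 * (α * β) * ((y * star x).re ^ 2 + (y * star x).imI ^ 2) := by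
  simp only [norm_sq_eq_sum, Quaternion.re_add, Quaternion.imI_add, Quaternion.imJ_add,
    Quaternion.imK_add, Quaternion.re_mul, Quaternion.imI_mul, Quaternion.imJ_mul,
    Quaternion.imK_mul, Quaternion.re_star, Quaternion.imI_star, Quaternion.imJ_star,
    Quaternion.imK_star, Quaternion.re_smul, Quaternion.imI_smul, Quaternion.imJ_smul,
    Quaternion.imK_smul, Quaternion.re_coeComplex, Quaternion.imI_coeComplex,
    Quaternion.imJ_coeComplex, Quaternion.imK_coeComplex, Complex.I_re, Complex.I_im, smul_eq_mul,
    mul_zero, mul_one]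
  ring

/-! ### Interpolation -/

/-- Moving from `(p, q)` along a line on which `c * p + d * q` is constant, one reaches every circle
around the origin that encloses `(p, q)`. -/
theorem exists_sq_add_sq_eq_of_le {p q R : ℝ} (c d : ℝ) (h : p ^ 2 + q ^ 2 ≤ R) :
    ∃ p' q' : ℝ, p' ^ 2 + q' ^ 2 = R ∧ c * p' + d * q' = c * p + d * q := by
  by_cases hN : c ^ 2 + d ^ 2 = 0
  · have hc : c = 0 := by nlinarith [sq_nonneg c, sq_nonneg d]
    have hd : d = 0 := by nlinarith [sq_nonneg c, sq_nonneg d]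
    refine ⟨√R, 0, ?_, by simp [hc, hd]⟩
    rw [Real.sq_sqrt (by nlinarith [sq_nonneg p, sq_nonneg q])]
    ring
  · set N := c ^ 2 + d ^ 2 with hNdef
    have hNpos : 0 < N := lt_of_le_of_ne (by positivity) (Ne.symm hN)
    set B := q * c - p * d with hB
    have hD : 0 ≤ B ^ 2 + N * (R - p ^ 2 - q ^ 2) := by
      have : 0 ≤ N * (R - p ^ 2 - q ^ 2) := mul_nonneg hNpos.le (by linarith)
      positivity
    obtain ⟨r, hr⟩ : ∃ r : ℝ, r ^ 2 = B ^ 2 + N * (R - p ^ 2 - q ^ 2) := ⟨_, Real.sq_sqrt hD⟩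
    obtain ⟨τ, hτ⟩ : ∃ τ : ℝ, N * τ = r - B := ⟨(r - B) / N, by field_simp⟩
    refine ⟨p - τ * d, q + τ * c, ?_, by ring⟩
    have key : N * ((p - τ * d) ^ 2 + (q + τ * c) ^ 2) = N * R := by
      have : r = N * τ + B := by linarith
      rw [this] at hr
      linear_combination hr
    exact mul_left_cancel₀ hN key

/-- Cauchy–Schwarz for the form `D ^ 2 + κ * (c ^ 2 + d ^ 2)`, with the norms `b₁`, `b₂` given
through their squares. -/
theorem mul_add_mul_le_of_sq_eq {b₁ b₂ D₁ D₂ κ c₁ c₂ d₁ d₂ : ℝ} (hκ : 0 ≤ κ)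
    (hb₁ : 0 ≤ b₁) (hb₂ : 0 ≤ b₂) (h₁ : b₁ ^ 2 = D₁ ^ 2 + κ * (c₁ ^ 2 + d₁ ^ 2))
    (h₂ : b₂ ^ 2 = D₂ ^ 2 + κ * (c₂ ^ 2 + d₂ ^ 2)) :
    D₁ * D₂ + κ * (c₁ * c₂ + d₁ * d₂) ≤ b₁ * b₂ := by
  refine le_trans (le_abs_self _) (abs_le_of_sq_le_sq ?_ (mul_nonneg hb₁ hb₂))
  have : (b₁ * b₂) ^ 2 = (D₁ * D₂ + κ * (c₁ * c₂ + d₁ * d₂)) ^ 2 +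
      (κ * ((D₁ * c₂ - D₂ * c₁) ^ 2 + (D₁ * d₂ - D₂ * d₁) ^ 2) +
        κ ^ 2 * (c₁ * d₂ - c₂ * d₁) ^ 2) := by
    rw [mul_pow, h₁, h₂]; ring
  rw [this]
  have : 0 ≤ κ * ((D₁ * c₂ - D₂ * c₁) ^ 2 + (D₁ * d₂ - D₂ * d₁) ^ 2) +
        κ ^ 2 * (c₁ * d₂ - c₂ * d₁) ^ 2 := by positivity
  linarith

/-- The cone `‖w‖ ^ 2 ≤ ξ * υ`, `0 ≤ ξ`, `0 ≤ υ` of positive semidefinite Hermitian `2 × 2` matrices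
is convex: a conical combination of two boundary points lies in it. -/
theorem norm_sq_combo_le {ξ₁ ξ₂ υ₁ υ₂ s t : ℝ} {w₁ w₂ : ℍ} (hs : 0 ≤ s) (ht : 0 ≤ t)
    (hξ₁ : 0 ≤ ξ₁) (hξ₂ : 0 ≤ ξ₂) (hυ₁ : 0 ≤ υ₁) (hυ₂ : 0 ≤ υ₂)
    (h₁ : ‖w₁‖ ^ 2 = ξ₁ * υ₁) (h₂ : ‖w₂‖ ^ 2 = ξ₂ * υ₂) :
    ‖s • w₁ + t • w₂‖ ^ 2 ≤ (s * ξ₁ + t * ξ₂) * (s * υ₁ + t * υ₂) := by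
  have hn : ‖s • w₁ + t • w₂‖ ≤ s * ‖w₁‖ + t * ‖w₂‖ := by
    refine (norm_add_le _ _).trans_eq ?_
    rw [norm_smul, norm_smul, Real.norm_of_nonneg hs, Real.norm_of_nonneg ht]
  have hm : 2 * (‖w₁‖ * ‖w₂‖) ≤ ξ₁ * υ₂ + ξ₂ * υ₁ := by
    refine le_trans (le_abs_self _) (abs_le_of_sq_le_sq ?_ (by positivity))
    have : (2 * (‖w₁‖ * ‖w₂‖)) ^ 2 = 4 * ((ξ₁ * υ₁) * (ξ₂ * υ₂)) := by
      rw [← h₁, ← h₂]; ring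
    rw [this]
    nlinarith [sq_nonneg (ξ₁ * υ₂ - ξ₂ * υ₁)]
  calc ‖s • w₁ + t • w₂‖ ^ 2 ≤ (s * ‖w₁‖ + t * ‖w₂‖) ^ 2 := by gcongr
    _ = s ^ 2 * ‖w₁‖ ^ 2 + t ^ 2 * ‖w₂‖ ^ 2 + s * t * (2 * (‖w₁‖ * ‖w₂‖)) := by ring
    _ ≤ s ^ 2 * ‖w₁‖ ^ 2 + t ^ 2 * ‖w₂‖ ^ 2 + s * t * (ξ₁ * υ₂ + ξ₂ * υ₁) := by gcongr
    _ = _ := by rw [h₁, h₂]; ring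

/-- The heart of the convexity proof. Here `ξ`, `υ` and `w` stand for `‖x‖ ^ 2`, `‖y‖ ^ 2` and
`y * star x`, and `b` for the norm of the imaginary part of a diagonal skew form with coefficients
`α` and `β`. Since `‖w‖ ^ 2 = ξ * υ`, there are two expressions for `b ^ 2`:
* `(α * ξ - β * υ) ^ 2 + 4 * α * β * (w.re ^ 2 + w.imI ^ 2)`, the square of a seminorm, and
* `(α * ξ + β * υ) ^ 2 - 4 * α * β * (w.imJ ^ 2 + w.imK ^ 2)`, the square of a concave function on
  the cone where it is defined.
So at the combination `v` of `w₁` and `w₂` the wanted value of `b` lies between the two square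
roots. The parts of `v` in the planes `⟨1, i⟩` and `⟨j, k⟩` are in general too short to give
`‖v‖ ^ 2 = ξ * υ`, and the two inequalities say that each can be lengthened by exactly what is required; this is done
without changing `(η * v).re`. -/
theorem exists_interpolating_quaternion {α β ξ₁ ξ₂ υ₁ υ₂ b₁ b₂ s t : ℝ} {w₁ w₂ : ℍ} (η : ℍ)
    (hα : 0 ≤ α) (hβ : 0 ≤ β) (hs : 0 ≤ s) (ht : 0 ≤ t)
    (hξ₁ : 0 ≤ ξ₁) (hξ₂ : 0 ≤ ξ₂) (hυ₁ : 0 ≤ υ₁) (hυ₂ : 0 ≤ υ₂)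
    (h₁ : ‖w₁‖ ^ 2 = ξ₁ * υ₁) (h₂ : ‖w₂‖ ^ 2 = ξ₂ * υ₂) (hb₁ : 0 ≤ b₁) (hb₂ : 0 ≤ b₂)
    (hk₁ : b₁ ^ 2 = (α * ξ₁ - β * υ₁) ^ 2 + 4 * (α * β) * (w₁.re ^ 2 + w₁.imI ^ 2))
    (hk₂ : b₂ ^ 2 = (α * ξ₂ - β * υ₂) ^ 2 + 4 * (α * β) * (w₂.re ^ 2 + w₂.imI ^ 2)) :
    ∃ w : ℍ, ‖w‖ ^ 2 = (s * ξ₁ + t * ξ₂) * (s * υ₁ + t * υ₂) ∧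
      (η * w).re = s * (η * w₁).re + t * (η * w₂).re ∧
      (s * b₁ + t * b₂) ^ 2 = (α * (s * ξ₁ + t * ξ₂) - β * (s * υ₁ + t * υ₂)) ^ 2 +
        4 * (α * β) * (w.re ^ 2 + w.imI ^ 2) := by
  have hw := norm_sq_combo_le hs ht hξ₁ hξ₂ hυ₁ hυ₂ h₁ h₂
  set ξ := s * ξ₁ + t * ξ₂ with hξ
  set υ := s * υ₁ + t * υ₂ with hυ
  set b := s * b₁ + t * b₂ with hb
  set v := s • w₁ + t • w₂ with hv
  have v0 : v.re = s * w₁.re + t * w₂.re := by simp [hv]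
  have v1 : v.imI = s * w₁.imI + t * w₂.imI := by simp [hv]
  have v2 : v.imJ = s * w₁.imJ + t * w₂.imJ := by simp [hv]
  have v3 : v.imK = s * w₁.imK + t * w₂.imK := by simp [hv]
  rw [norm_sq_eq_sum] at hw h₁ h₂
  -- `R` and `S` are the squared lengths that the two planar parts of `w` are to have.
  suffices H : ∃ R S : ℝ, R + S = ξ * υ ∧ v.re ^ 2 + v.imI ^ 2 ≤ R ∧ v.imJ ^ 2 + v.imK ^ 2 ≤ S ∧
      b ^ 2 = (α * ξ - β * υ) ^ 2 + 4 * (α * β) * R by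
    obtain ⟨R, S, hRS, hR, hS, hbR⟩ := H
    obtain ⟨c, d, hcd, hl⟩ := exists_sq_add_sq_eq_of_le η.re (-η.imI) hR
    obtain ⟨e, g, heg, hl'⟩ := exists_sq_add_sq_eq_of_le (-η.imJ) (-η.imK) hS
    obtain ⟨w, hw0, hw1, hw2, hw3⟩ : ∃ w : ℍ, w.re = c ∧ w.imI = d ∧ w.imJ = e ∧ w.imK = g :=
      ⟨⟨c, d, e, g⟩, rfl, rfl, rfl, rfl⟩
    refine ⟨w, ?_, ?_, ?_⟩
    · rw [norm_sq_eq_sum, hw0, hw1, hw2, hw3]; linarith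
    · simp only [Quaternion.re_mul, hw0, hw1, hw2, hw3]
      rw [v0, v1] at hl
      rw [v2, v3] at hl'
      linear_combination hl + hl'
    · rw [hw0, hw1, hcd]; exact hbR
  have hκ : 0 ≤ 4 * (α * β) := by positivity
  rcases eq_or_lt_of_le hκ with h0 | hpos
  -- If `α * β = 0`, then `b` is linear in `ξ` and `υ`, and `R`, `S` need only have the right sum.
  · have e₁ : b₁ = α * ξ₁ + β * υ₁ := by
      refine (sq_eq_sq₀ hb₁ (by positivity)).1 ?_
      rw [hk₁]; linear_combination (w₁.re ^ 2 + w₁.imI ^ 2 - ξ₁ * υ₁) * -h0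
    have e₂ : b₂ = α * ξ₂ + β * υ₂ := by
      refine (sq_eq_sq₀ hb₂ (by positivity)).1 ?_
      rw [hk₂]; linear_combination (w₂.re ^ 2 + w₂.imI ^ 2 - ξ₂ * υ₂) * -h0
    refine ⟨ξ * υ - (v.imJ ^ 2 + v.imK ^ 2), v.imJ ^ 2 + v.imK ^ 2, by ring, by linarith,
      le_rfl, ?_⟩
    rw [← h0, hb, e₁, e₂, hξ, hυ]
    linear_combination (-(s * ξ₁ + t * ξ₂) * (s * υ₁ + t * υ₂)) * h0
  · have lower : (α * ξ - β * υ) ^ 2 + 4 * (α * β) * (v.re ^ 2 + v.imI ^ 2) ≤ b ^ 2 := by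
      have := mul_le_mul_of_nonneg_left (mul_add_mul_le_of_sq_eq hκ hb₁ hb₂ hk₁ hk₂)
        (mul_nonneg hs ht)
      rw [v0, v1, hb, hξ, hυ]
      linear_combination 2 * this - s ^ 2 * hk₁ - t ^ 2 * hk₂
    have upper : b ^ 2 ≤ (α * ξ + β * υ) ^ 2 - 4 * (α * β) * (v.imJ ^ 2 + v.imK ^ 2) := by
      have k₁ : (α * ξ₁ + β * υ₁) ^ 2 = b₁ ^ 2 + 4 * (α * β) * (w₁.imJ ^ 2 + w₁.imK ^ 2) := by
        rw [hk₁]; linear_combination (- 4 * (α * β)) * h₁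
      have k₂ : (α * ξ₂ + β * υ₂) ^ 2 = b₂ ^ 2 + 4 * (α * β) * (w₂.imJ ^ 2 + w₂.imK ^ 2) := by
        rw [hk₂]; linear_combination (- 4 * (α * β)) * h₂
      have := mul_le_mul_of_nonneg_left (mul_add_mul_le_of_sq_eq hκ
        (by positivity) (by positivity) k₁ k₂) (mul_nonneg hs ht)
      rw [v2, v3, hb, hξ, hυ]
      linear_combination 2 * this - s ^ 2 * k₁ - t ^ 2 * k₂
    refine ⟨(b ^ 2 - (α * ξ - β * υ) ^ 2) / (4 * (α * β)),
      ((α * ξ + β * υ) ^ 2 - b ^ 2) / (4 * (α * β)), ?_, ?_, ?_, ?_⟩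
    · rw [← add_div, div_eq_iff hpos.ne']; ring
    · rw [le_div_iff₀ hpos]; linarith
    · rw [le_div_iff₀ hpos]; linarith
    · rw [mul_div_cancel₀ _ hpos.ne']; ring

/-- The boundary points of the cone `‖w‖ ^ 2 ≤ ξ * υ` have rank one: they come from vectors
`(x, y)`. -/
theorem exists_mul_star_eq {ξ υ : ℝ} {w : ℍ} (hξ : 0 ≤ ξ) (hυ : 0 ≤ υ)
    (h : ‖w‖ ^ 2 = ξ * υ) : ∃ x y : ℍ, ‖x‖ ^ 2 = ξ ∧ ‖y‖ ^ 2 = υ ∧ y * star x = w := by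
  rcases eq_or_lt_of_le hξ with h0 | hpos
  · have hw : w = 0 := by simpa [← h0] using h
    exact ⟨0, (√υ : ℝ), by simp [← h0], by simp [Real.sq_sqrt hυ], by simp [hw]⟩
  · have hr : √ξ ≠ 0 := (Real.sqrt_pos.2 hpos).ne'
    refine ⟨(√ξ : ℝ), (√ξ)⁻¹ • w, by simp [Real.sq_sqrt hξ], ?_, ?_⟩
    · rw [norm_smul, mul_pow, h, norm_inv, Real.norm_of_nonneg (Real.sqrt_nonneg _), inv_pow,
        Real.sq_sqrt hξ]
      field_simp
    · rw [Quaternion.star_coe, Quaternion.mul_coe_eq_smul, smul_smul, mul_inv_cancel₀ hr, one_smul]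

/-! ### The form of a matrix -/

theorem quatInner_eq_dotProduct {n : ℕ} (X Y : Fin n → ℍ) : quatInner X Y = star X ⬝ᵥ Y := rfl

theorem star_quatInner {n : ℕ} (X Y : Fin n → ℍ) : star (quatInner X Y) = quatInner Y X := by
  simp [quatInner]

theorem quatInner_sub_right {n : ℕ} (X Y Z : Fin n → ℍ) :
    quatInner X (Y - Z) = quatInner X Y - quatInner X Z := by
  simp [quatInner, mul_sub, Finset.sum_sub_distrib]

theorem quatInner_op_smul_right {n : ℕ} (X Y : Fin n → ℍ) (p : ℍ) :
    quatInner X (op p • Y) = quatInner X Y * p := by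
  simp [quatInner, Finset.sum_mul, mul_assoc]

theorem quatInner_op_smul_left {n : ℕ} (X Y : Fin n → ℍ) (p : ℍ) :
    quatInner (op p • X) Y = star p * quatInner X Y := by
  simp [quatInner, Finset.mul_sum, mul_assoc]

theorem quatInner_mulVec_right {n k : ℕ} (A : Matrix (Fin k) (Fin n) ℍ) (X : Fin k → ℍ)
    (Y : Fin n → ℍ) : quatInner X (A *ᵥ Y) = quatInner (Aᴴ *ᵥ X) Y := by
  rw [quatInner_eq_dotProduct, quatInner_eq_dotProduct, star_mulVec, conjTranspose_conjTranspose,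
    dotProduct_mulVec]

theorem quatInner_self_eq_one_iff {n : ℕ} (X : EuclideanSpace ℍ (Fin n)) :
    quatInner X.ofLp X.ofLp = 1 ↔ ‖X‖ = 1 := by
  rw [quatInner_self, ← Quaternion.coe_one, Quaternion.coe_inj,
    pow_eq_one_iff_of_nonneg (norm_nonneg X) two_ne_zero]

theorem mem_numericalRange_iff {n : ℕ} {A : Matrix (Fin n) (Fin n) ℍ} {q : ℍ} :
    q ∈ numericalRange A ↔
      ∃ X : Fin n → ℍ, quatInner X X = 1 ∧ q = quatInner X (A *ᵥ X) := by
  constructor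
  · rintro ⟨X, hX, rfl⟩
    exact ⟨X.ofLp, (quatInner_self_eq_one_iff X).2 hX, rfl⟩
  · rintro ⟨X, hX, rfl⟩
    exact ⟨WithLp.toLp 2 X, (quatInner_self_eq_one_iff _).1 hX, rfl⟩

theorem quatInner_op_smul_self {n : ℕ} {X : Fin n → ℍ} (hX : quatInner X X = 1) {u : ℍ}
    (hu : ‖u‖ = 1) : quatInner (op u • X) (op u • X) = 1 := by
  rw [quatInner_op_smul_left, quatInner_op_smul_right, hX, one_mul, star_mul_self_eq_one hu]

theorem quatInner_mulVec_op_smul {n : ℕ} (A : Matrix (Fin n) (Fin n) ℍ) (X Y : Fin n → ℍ)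
    (u v : ℍ) : quatInner (op u • X) (A *ᵥ (op v • Y)) = star u * quatInner X (A *ᵥ Y) * v := by
  rw [mulVec_smul, quatInner_op_smul_left, quatInner_op_smul_right, mul_assoc]

theorem conj_mem_numericalRange {n : ℕ} {A : Matrix (Fin n) (Fin n) ℍ} {q u : ℍ}
    (hq : q ∈ numericalRange A) (hu : ‖u‖ = 1) : star u * q * u ∈ numericalRange A := by
  obtain ⟨X, hX, rfl⟩ := mem_numericalRange_iff.1 hq
  exact mem_numericalRange_iff.2 ⟨op u • X, quatInner_op_smul_self hX hu,
    (quatInner_mulVec_op_smul A X X u u).symm⟩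

/-! ### Compressions and unitary equivalence -/

/-- The sesquilinear form of `A`, restricted to the range of `V`, is that of `Vᴴ * A * V`. -/
theorem quatInner_compression {n k : ℕ} (A : Matrix (Fin n) (Fin n) ℍ)
    (V : Matrix (Fin n) (Fin k) ℍ) (x y : Fin k → ℍ) :
    quatInner (V *ᵥ x) (A *ᵥ (V *ᵥ y)) = quatInner x ((Vᴴ * A * V) *ᵥ y) := by
  rw [← mulVec_mulVec, ← mulVec_mulVec, quatInner_mulVec_right Vᴴ, conjTranspose_conjTranspose]

theorem quatInner_isometry {n k : ℕ} {V : Matrix (Fin n) (Fin k) ℍ} (hV : Vᴴ * V = 1)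
    (x y : Fin k → ℍ) : quatInner (V *ᵥ x) (V *ᵥ y) = quatInner x y := by
  simpa [hV] using quatInner_compression 1 V x y

theorem numericalRange_compression_subset {n k : ℕ} (A : Matrix (Fin n) (Fin n) ℍ)
    {V : Matrix (Fin n) (Fin k) ℍ} (hV : Vᴴ * V = 1) :
    numericalRange (Vᴴ * A * V) ⊆ numericalRange A := by
  intro q hq
  obtain ⟨x, hx, rfl⟩ := mem_numericalRange_iff.1 hq
  exact mem_numericalRange_iff.2 ⟨V *ᵥ x, by rw [quatInner_isometry hV, hx],
    (quatInner_compression A V x x).symm⟩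

theorem numericalRange_unitary_conj {n : ℕ} (A : Matrix (Fin n) (Fin n) ℍ)
    {U : Matrix (Fin n) (Fin n) ℍ} (hU : Uᴴ * U = 1) :
    numericalRange (Uᴴ * A * U) = numericalRange A := by
  refine (numericalRange_compression_subset A hU).antisymm ?_
  have hU' : U * Uᴴ = 1 := mul_eq_one_comm.1 hU
  have h := numericalRange_compression_subset (Uᴴ * A * U) (V := Uᴴ) (by simpa using hU')
  have e : Uᴴᴴ * (Uᴴ * A * U) * Uᴴ = A := by
    rw [conjTranspose_conjTranspose]
    calc U * (Uᴴ * A * U) * Uᴴ = (U * Uᴴ) * A * (U * Uᴴ) := by simp only [Matrix.mul_assoc]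
      _ = A := by rw [hU', Matrix.one_mul, Matrix.mul_one]
  rwa [e] at h

/-- The matrix with columns `e` and `f`. -/
def twoCols {n : ℕ} (e f : Fin n → ℍ) : Matrix (Fin n) (Fin 2) ℍ := Matrix.of fun l => ![e l, f l]

theorem twoCols_mulVec {n : ℕ} (e f : Fin n → ℍ) (x : Fin 2 → ℍ) :
    twoCols e f *ᵥ x = op (x 0) • e + op (x 1) • f := by
  ext1 l
  simp [twoCols, mulVec, dotProduct, Fin.sum_univ_two]

theorem twoCols_isometry {n : ℕ} {e f : Fin n → ℍ} (he : quatInner e e = 1)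
    (hf : quatInner f f = 1) (hef : quatInner e f = 0) :
    (twoCols e f)ᴴ * twoCols e f = 1 := by
  have hfe : quatInner f e = 0 := by rw [← star_quatInner, hef, star_zero]
  ext1 i j
  fin_cases i <;> fin_cases j <;> simpa [Matrix.mul_apply, twoCols, quatInner]

theorem twoCols_compression {n : ℕ} (A : Matrix (Fin n) (Fin n) ℍ) (e f : Fin n → ℍ) :
    (twoCols e f)ᴴ * A * twoCols e f =
      !![quatInner e (A *ᵥ e), quatInner e (A *ᵥ f);
        quatInner f (A *ᵥ e), quatInner f (A *ᵥ f)] := by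
  rw [Matrix.mul_assoc]
  ext1 i j
  fin_cases i <;> fin_cases j <;>
    simp [Matrix.mul_apply, twoCols, quatInner, mulVec, dotProduct]

/-! ### Orthonormal vectors and eigenvectors -/

theorem exists_normalize {n : ℕ} {X : Fin n → ℍ} (hX : X ≠ 0) :
    ∃ r : ℝ, r ≠ 0 ∧ quatInner (op (r : ℍ) • X) (op (r : ℍ) • X) = 1 := by
  have h := quatInner_self (WithLp.toLp 2 X)
  simp only at h
  have hn : ‖WithLp.toLp 2 X‖ ≠ 0 := by simpa using hX
  refine ⟨‖WithLp.toLp 2 X‖⁻¹, inv_ne_zero hn, ?_⟩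
  rw [quatInner_op_smul_left, quatInner_op_smul_right, h, Quaternion.star_coe,
    ← Quaternion.coe_mul, ← Quaternion.coe_mul, ← Quaternion.coe_one]
  congr 1
  field_simp

/-- One step of the Gram–Schmidt process: `Y` is a right multiple of the unit vector `X`, or both
lie in the right span of an orthonormal pair `X, f`. -/
theorem gram_schmidt {n : ℕ} {X Y : Fin n → ℍ} (hX : quatInner X X = 1) :
    (∃ p : ℍ, Y = op p • X) ∨ ∃ f : Fin n → ℍ, quatInner f f = 1 ∧ quatInner X f = 0 ∧
      ∃ p q : ℍ, Y = op p • X + op q • f := by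
  by_cases h : Y - op (quatInner X Y) • X = 0
  · exact .inl ⟨_, sub_eq_zero.1 h⟩
  · obtain ⟨r, hr, hf⟩ := exists_normalize h
    refine .inr ⟨_, hf, ?_, quatInner X Y, ((r⁻¹ : ℝ) : ℍ), ?_⟩
    · rw [quatInner_op_smul_right, quatInner_sub_right, quatInner_op_smul_right, hX, one_mul,
        sub_self, zero_mul]
    · rw [smul_smul, ← op_mul, ← Quaternion.coe_mul, mul_inv_cancel₀ hr]
      simp

theorem exists_orthogonal_unit (e : Fin 2 → ℍ) :
    ∃ f : Fin 2 → ℍ, quatInner f f = 1 ∧ quatInner e f = 0 := by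
  suffices H : ∃ g : Fin 2 → ℍ, g ≠ 0 ∧ quatInner e g = 0 by
    obtain ⟨g, hg, hge⟩ := H
    obtain ⟨r, -, hr⟩ := exists_normalize hg
    exact ⟨_, hr, by rw [quatInner_op_smul_right, hge, zero_mul]⟩
  by_cases h : e 0 = 0
  · refine ⟨![1, 0], fun h => one_ne_zero (congrFun h 0), ?_⟩
    simp [quatInner, Fin.sum_univ_two, h]
  · refine ⟨![-((star (e 0))⁻¹ * star (e 1)), 1], fun h => one_ne_zero (congrFun h 1), ?_⟩
    have : star (e 0) ≠ 0 := by simpa using h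
    simp [quatInner, Fin.sum_univ_two, mul_inv_cancel_left₀ this]

/-- The real inner product that Mathlib puts on `ℍⁿ` is the real part of `quatInner`. -/
theorem real_inner_eq_re_quatInner {n : ℕ} (Z W : EuclideanSpace ℍ (Fin n)) :
    inner ℝ Z W = (quatInner Z.ofLp W.ofLp).re := by
  have : ∀ s : Finset (Fin n), (∑ l ∈ s, star (Z l) * W l).re = ∑ l ∈ s, (star (Z l) * W l).re :=
    fun s => map_sum (QuaternionAlgebra.reₗ (R := ℝ) (-1) 0 (-1)) _ s
  rw [PiLp.inner_apply, quatInner, this]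
  refine Finset.sum_congr rfl fun l _ => ?_
  rw [Quaternion.inner_def]
  simp

/-- A skew-Hermitian quaternionic matrix has a right eigenvector: `Z ↦ C Z i` is a symmetric
operator on the real inner product space `ℍⁿ`, and an eigenvector of it with real eigenvalue `μ`
satisfies `C Z = Z (-μ i)`. -/
theorem exists_eigenvector {n : ℕ} [NeZero n] {C : Matrix (Fin n) (Fin n) ℍ} (hC : Cᴴ = -C) :
    ∃ e : Fin n → ℍ, quatInner e e = 1 ∧ ∃ μ : ℍ, C *ᵥ e = op μ • e := by
  set i : ℍ := ((Complex.I : ℂ) : ℍ) with hi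
  have hii : i * i = -1 := by rw [hi, ← Quaternion.coeComplex_mul, Complex.I_mul_I]; ext <;> simp
  have his : star i = -i := by ext <;> simp [hi]
  let T : EuclideanSpace ℍ (Fin n) →ₗ[ℝ] EuclideanSpace ℍ (Fin n) :=
    { toFun := fun Z => WithLp.toLp 2 (op i • (C *ᵥ Z.ofLp))
      map_add' := fun Z W => by ext1 l; simp [mulVec_add]
      map_smul' := fun r Z => by ext1 l; simp [mulVec_smul] }
  have hT : T.IsSymmetric := by
    intro Z W
    rw [real_inner_eq_re_quatInner, real_inner_eq_re_quatInner]
    change (quatInner (op i • (C *ᵥ Z.ofLp)) W.ofLp).re =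
      (quatInner Z.ofLp (op i • (C *ᵥ W.ofLp))).re
    have : quatInner (C *ᵥ Z.ofLp) W.ofLp = - quatInner Z.ofLp (C *ᵥ W.ofLp) := by
      rw [quatInner_mulVec_right, hC]; simp [neg_mulVec, quatInner]
    rw [quatInner_op_smul_left, quatInner_op_smul_right, this, his, neg_mul_neg]
    simp only [Quaternion.re_mul]; ring
  have hev := hT.hasEigenvalue_iSup_of_finiteDimensional
  obtain ⟨Z, hZ⟩ := hev.exists_hasEigenvector
  generalize (⨆ x : { x : EuclideanSpace ℍ (Fin n) // x ≠ 0 }, _ : ℝ) = μ at hZ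
  obtain ⟨r, hr, hr1⟩ := exists_normalize (X := Z.ofLp) (by simpa using hZ.2)
  refine ⟨_, hr1, (-μ) • i, ?_⟩
  have hZ1 : op i • (C *ᵥ Z.ofLp) = μ • Z.ofLp := congrArg WithLp.ofLp hZ.apply_eq_smul
  have hZ2 : C *ᵥ Z.ofLp = op ((-μ) • i) • Z.ofLp := by
    have := congrArg (fun v => op (-i) • v) hZ1
    simp only [smul_smul, ← op_mul, mul_neg, hii, neg_neg, op_one, one_smul] at this
    rw [this]
    ext1 l
    simp
  rw [mulVec_smul, hZ2, smul_smul, smul_smul, ← op_mul, ← op_mul, Quaternion.coe_commutes]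

/-! ### The numerical range modulo conjugation -/

/-- The numerical range up to conjugation by unit quaternions: the pairs consisting of the real part
and the norm of the imaginary part of its elements, a subset of the closed upper half plane. -/
def bild {n : ℕ} (A : Matrix (Fin n) (Fin n) ℍ) : Set (ℝ × ℝ) :=
  (fun q : ℍ => (q.re, ‖q.im‖)) '' numericalRange A

theorem mem_numericalRange_iff_mem_bild {n : ℕ} {A : Matrix (Fin n) (Fin n) ℍ} {q : ℍ} :
    q ∈ numericalRange A ↔ (q.re, ‖q.im‖) ∈ bild A := by
  refine ⟨fun h => ⟨q, h, rfl⟩, ?_⟩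
  rintro ⟨p, hp, h⟩
  obtain ⟨hre, him⟩ := Prod.ext_iff.1 h
  obtain ⟨u, hu, rfl⟩ := exists_conj_eq hre him
  exact conj_mem_numericalRange hp hu

theorem conj_bild_eq (q : ℍ) {u : ℍ} (hu : ‖u‖ = 1) :
    ((star u * q * u).re, ‖(star u * q * u).im‖) = (q.re, ‖q.im‖) := by
  have hre : (star u * q * u).re = q.re := by
    have h : u * star u = 1 := by
      rw [Quaternion.self_mul_star, Quaternion.normSq_eq_norm_mul_self, hu]; simp
    have : (star u * q * u).re = (q * (u * star u)).re := by
      simp only [Quaternion.re_mul, Quaternion.imI_mul, Quaternion.imJ_mul, Quaternion.imK_mul,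
        Quaternion.re_star, Quaternion.imI_star, Quaternion.imJ_star, Quaternion.imK_star]
      ring
    rw [this, h, mul_one]
  refine Prod.ext hre ((sq_eq_sq₀ (norm_nonneg _) (norm_nonneg _)).1 ?_)
  rw [norm_im_sq, norm_im_sq, hre, norm_mul, norm_mul, norm_star, hu, one_mul, mul_one]

/-- The quaternionic `2 × 2` matrices whose skew-Hermitian part is diagonal with entries `α i` and
`β i`. -/
noncomputable def normalForm (α β h₁ h₂ : ℝ) (η : ℍ) : Matrix (Fin 2) (Fin 2) ℍ :=
  !![(h₁ : ℍ) + α • ((Complex.I : ℂ) : ℍ), η; star η, (h₂ : ℍ) + β • ((Complex.I : ℂ) : ℍ)]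

/-- Every `2 × 2` matrix has the numerical range of a normal form, to which it is unitarily
equivalent: diagonalise the skew-Hermitian part, and multiply the two eigenvectors by unit
quaternions that turn its diagonal entries into nonnegative multiples of `i`. -/
theorem exists_normalForm (A : Matrix (Fin 2) (Fin 2) ℍ) :
    ∃ (α β h₁ h₂ : ℝ) (η : ℍ), 0 ≤ α ∧ 0 ≤ β ∧
      numericalRange (normalForm α β h₁ h₂ η) = numericalRange A := by
  have hC : (A - Aᴴ)ᴴ = -(A - Aᴴ) := by simp
  obtain ⟨e, he, μ, hμ⟩ := exists_eigenvector hC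
  obtain ⟨f, hf, hef⟩ := exists_orthogonal_unit e
  have rot : ∀ q : ℍ, ∃ u : ℍ, ‖u‖ = 1 ∧
      star u * q * u = (q.re : ℍ) + ‖q.im‖ • ((Complex.I : ℂ) : ℍ) := by
    intro q
    have hI : (‖q.im‖ • ((Complex.I : ℂ) : ℍ)).re = 0 := by simp
    refine exists_conj_eq (re_coe_add _ hI).symm ?_
    rw [im_coe_add _ hI, norm_smul, norm_coeComplex_I, norm_norm, mul_one]
  obtain ⟨u, hu, hue⟩ := rot (quatInner e (A *ᵥ e))
  obtain ⟨v, hv, hvf⟩ := rot (quatInner f (A *ᵥ f))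
  have hfe : quatInner f e = 0 := by rw [← star_quatInner, hef, star_zero]
  have hoff : quatInner f (A *ᵥ e) = star (quatInner e (A *ᵥ f)) := by
    have h0 : quatInner f ((A - Aᴴ) *ᵥ e) = 0 := by
      rw [hμ, quatInner_op_smul_right, hfe, zero_mul]
    rw [sub_mulVec, quatInner_sub_right, sub_eq_zero] at h0
    rw [star_quatInner, h0, quatInner_mulVec_right, conjTranspose_conjTranspose]
  refine ⟨‖(quatInner e (A *ᵥ e)).im‖, ‖(quatInner f (A *ᵥ f)).im‖, (quatInner e (A *ᵥ e)).re,
    (quatInner f (A *ᵥ f)).re, star u * quatInner e (A *ᵥ f) * v, norm_nonneg _, norm_nonneg _, ?_⟩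
  rw [← numericalRange_unitary_conj A (twoCols_isometry (quatInner_op_smul_self he hu)
    (quatInner_op_smul_self hf hv)
      (by simp [quatInner_op_smul_left, quatInner_op_smul_right, hef])),
    twoCols_compression, normalForm]
  simp only [quatInner_mulVec_op_smul, hue, hvf, hoff, star_mul, star_star, mul_assoc]

/-- The value of the form of a normal form, split into its real and imaginary parts. -/
theorem quatInner_normalForm (α β h₁ h₂ : ℝ) (η : ℍ) (X : Fin 2 → ℍ) :
    quatInner X (normalForm α β h₁ h₂ η *ᵥ X) =
      ((h₁ * ‖X 0‖ ^ 2 + h₂ * ‖X 1‖ ^ 2 + 2 * (η * (X 1 * star (X 0))).re : ℝ) : ℍ) +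
      (star (X 0) * (α • ((Complex.I : ℂ) : ℍ)) * X 0 +
        star (X 1) * (β • ((Complex.I : ℂ) : ℍ)) * X 1) := by
  have hd : ∀ (h : ℝ) (x : ℍ), star x * (h : ℍ) * x = ((h * ‖x‖ ^ 2 : ℝ) : ℍ) := by
    intro h x
    rw [← Quaternion.coe_commutes, mul_assoc, Quaternion.star_mul_self,
      Quaternion.normSq_eq_norm_mul_self, ← sq, ← Quaternion.coe_mul]
  have ho : star (X 0) * (η * X 1) + star (X 1) * (star η * X 0) =
      ((2 * (η * (X 1 * star (X 0))).re : ℝ) : ℍ) := by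
    have h2 : star (X 1) * (star η * X 0) = star (star (X 0) * (η * X 1)) := by simp [mul_assoc]
    have h3 : (η * (X 1 * star (X 0))).re = (star (X 0) * (η * X 1)).re := by
      simp only [Quaternion.re_mul, Quaternion.imI_mul, Quaternion.imJ_mul, Quaternion.imK_mul,
        Quaternion.re_star, Quaternion.imI_star, Quaternion.imJ_star, Quaternion.imK_star]
      ring
    rw [h2, h3, Quaternion.self_add_star, Quaternion.coe_mul]
    rfl
  rw [Quaternion.coe_add, Quaternion.coe_add, ← hd, ← hd, ← ho]
  simp [normalForm, quatInner, mulVec, dotProduct, Fin.sum_univ_two, mul_add, add_mul, mul_assoc]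
  abel

theorem convex_bild_normalForm {α β : ℝ} (hα : 0 ≤ α) (hβ : 0 ≤ β) (h₁ h₂ : ℝ) (η : ℍ) :
    Convex ℝ (bild (normalForm α β h₁ h₂ η)) := by
  set B := normalForm α β h₁ h₂ η with hB
  have h0 : ∀ x y : ℍ, (star x * (α • ((Complex.I : ℂ) : ℍ)) * x +
      star y * (β • ((Complex.I : ℂ) : ℍ)) * y).re = 0 := by
    intro x y
    simp only [Quaternion.re_add, Quaternion.re_mul, Quaternion.imI_mul, Quaternion.imJ_mul,
      Quaternion.imK_mul, Quaternion.re_star, Quaternion.imI_star, Quaternion.imJ_star,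
      Quaternion.imK_star, Quaternion.re_smul, Quaternion.imI_smul, Quaternion.imJ_smul,
      Quaternion.imK_smul, Quaternion.re_coeComplex, Quaternion.imI_coeComplex,
      Quaternion.imJ_coeComplex, Quaternion.imK_coeComplex, Complex.I_re, Complex.I_im, smul_eq_mul]
    ring
  have hre : ∀ X : Fin 2 → ℍ, (quatInner X (B *ᵥ X)).re =
      h₁ * ‖X 0‖ ^ 2 + h₂ * ‖X 1‖ ^ 2 + 2 * (η * (X 1 * star (X 0))).re := by
    intro X
    rw [hB, quatInner_normalForm, re_coe_add _ (h0 _ _)]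
  have him : ∀ X : Fin 2 → ℍ, ‖(quatInner X (B *ᵥ X)).im‖ ^ 2 =
      (α * ‖X 0‖ ^ 2 - β * ‖X 1‖ ^ 2) ^ 2 +
        4 * (α * β) * ((X 1 * star (X 0)).re ^ 2 + (X 1 * star (X 0)).imI ^ 2) := by
    intro X
    rw [hB, quatInner_normalForm, im_coe_add _ (h0 _ _), norm_sq_star_mul_I_mul_add]
  have hone : ∀ X : Fin 2 → ℍ, quatInner X X = 1 ↔ ‖X 0‖ ^ 2 + ‖X 1‖ ^ 2 = 1 := by
    intro X
    simp only [quatInner, Fin.sum_univ_two, Quaternion.star_mul_self,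
      Quaternion.normSq_eq_norm_mul_self, ← sq]
    rw [← Quaternion.coe_add, ← Quaternion.coe_one, Quaternion.coe_inj]
  have hw : ∀ X : Fin 2 → ℍ, ‖X 1 * star (X 0)‖ ^ 2 = ‖X 0‖ ^ 2 * ‖X 1‖ ^ 2 := by
    intro X
    rw [norm_mul, norm_star]; ring
  rintro _ ⟨_, hp, rfl⟩ _ ⟨_, hq, rfl⟩ s t hs ht hst
  obtain ⟨X, hX, rfl⟩ := mem_numericalRange_iff.1 hp
  obtain ⟨Y, hY, rfl⟩ := mem_numericalRange_iff.1 hq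
  obtain ⟨w, hw1, hw2, hw3⟩ := exists_interpolating_quaternion η hα hβ hs ht (sq_nonneg _)
    (sq_nonneg _) (sq_nonneg _) (sq_nonneg _) (hw X) (hw Y) (norm_nonneg _) (norm_nonneg _)
    (him X) (him Y)
  obtain ⟨x, y, hx, hy, hxy⟩ := exists_mul_star_eq (by positivity) (by positivity) hw1
  rw [hone] at hX hY
  refine ⟨quatInner ![x, y] (B *ᵥ ![x, y]), mem_numericalRange_iff.2 ⟨_, ?_, rfl⟩,
    Prod.ext ?_ ?_⟩
  · rw [hone]
    simp only [cons_val_zero, cons_val_one]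
    rw [hx, hy]
    linear_combination s * hX + t * hY + hst
  · simp only [hre, cons_val_zero, cons_val_one, hx, hy, hxy, hw2, Prod.fst_add, Prod.smul_fst,
      smul_eq_mul]
    ring
  · refine (sq_eq_sq₀ (norm_nonneg _) ?_).1 ?_
    · simp; positivity
    · simp only [him, cons_val_zero, cons_val_one, hx, hy, hxy, Prod.snd_add, Prod.smul_snd,
        smul_eq_mul, hw3]

/-- Two unit vectors and the points they give involve only the compression of `A` to the right span
of the vectors, so the convexity of the numerical range modulo conjugation follows from the `2 × 2`
case. -/
theorem convex_bild {n : ℕ} (A : Matrix (Fin n) (Fin n) ℍ) : Convex ℝ (bild A) := by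
  rintro _ ⟨_, hp, rfl⟩ _ ⟨_, hq, rfl⟩ s t hs ht hst
  obtain ⟨X, hX, rfl⟩ := mem_numericalRange_iff.1 hp
  obtain ⟨Y, hY, rfl⟩ := mem_numericalRange_iff.1 hq
  rcases gram_schmidt (Y := Y) hX with ⟨u, rfl⟩ | ⟨f, hf, hXf, a, b, rfl⟩
  -- Right multiplication by a unit does not change the point modulo conjugation.
  · have hu : ‖u‖ = 1 := by
      rw [quatInner_op_smul_left, quatInner_op_smul_right, hX, one_mul, Quaternion.star_mul_self,
        ← Quaternion.coe_one, Quaternion.coe_inj, Quaternion.normSq_eq_norm_mul_self, ← sq] at hY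
      exact (pow_eq_one_iff_of_nonneg (norm_nonneg u) two_ne_zero).1 hY
    simp only
    rw [quatInner_mulVec_op_smul, conj_bild_eq _ hu, ← add_smul, hst, one_smul]
    exact mem_numericalRange_iff_mem_bild.1 hp
  · have hV := twoCols_isometry hX hf hXf
    set V := twoCols X f with hVdef
    have eX : X = V *ᵥ ![1, 0] := by rw [hVdef, twoCols_mulVec]; simp
    have eY : op a • X + op b • f = V *ᵥ ![a, b] := by rw [hVdef, twoCols_mulVec]; simp
    have mem : ∀ x : Fin 2 → ℍ, quatInner (V *ᵥ x) (V *ᵥ x) = 1 →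
        quatInner (V *ᵥ x) (A *ᵥ (V *ᵥ x)) ∈ numericalRange (Vᴴ * A * V) := by
      intro x hx
      rw [quatInner_isometry hV] at hx
      exact mem_numericalRange_iff.2 ⟨x, hx, quatInner_compression A V x x⟩
    have hp' := mem ![1, 0] (by rwa [← eX])
    have hq' := mem ![a, b] (by rwa [← eY])
    rw [← eX] at hp'
    rw [← eY] at hq'
    refine Set.image_mono (numericalRange_compression_subset A hV) ?_
    obtain ⟨α, β, h₁, h₂, η, hα, hβ, hW⟩ := exists_normalForm (Vᴴ * A * V)
    have hc := convex_bild_normalForm hα hβ h₁ h₂ η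
    rw [bild, hW] at hc
    exact hc ⟨_, hp', rfl⟩ ⟨_, hq', rfl⟩ hs ht hst

/-! ### Sections by upper half slices -/

/-- In an upper half slice, the real part and the norm of the imaginary part are the coordinates. -/
theorem bild_slice {m : ℍ} (hm : m ∈ imaginaryUnits) (α : ℝ) {β : ℝ} (hβ : 0 ≤ β) :
    (((α : ℍ) + m * (β : ℍ)).re, ‖((α : ℍ) + m * (β : ℍ)).im‖) = (α, β) := by
  obtain ⟨hs, hn⟩ := hm
  have h0 : m.re = 0 := by
    have := congrArg QuaternionAlgebra.re hs
    rw [Quaternion.re_star, Quaternion.re_neg] at this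
    linarith
  have h1 : (m * (β : ℍ)).re = 0 := by simp [h0]
  rw [re_coe_add _ h1, im_coe_add _ h1, norm_mul, hn, one_mul, Quaternion.norm_coe,
    Real.norm_of_nonneg hβ]

theorem slice_mem {n : ℕ} (A : Matrix (Fin n) (Fin n) ℍ) {m : ℍ} (hm : m ∈ imaginaryUnits)
    {α₁ α₂ β₁ β₂ s t : ℝ} (hβ₁ : 0 ≤ β₁) (hβ₂ : 0 ≤ β₂) (hs : 0 ≤ s) (ht : 0 ≤ t) (hst : s + t = 1)
    (h₁ : (α₁ : ℍ) + m * (β₁ : ℍ) ∈ numericalRange A)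
    (h₂ : (α₂ : ℍ) + m * (β₂ : ℍ) ∈ numericalRange A) :
    ((s * α₁ + t * α₂ : ℝ) : ℍ) + m * ((s * β₁ + t * β₂ : ℝ) : ℍ) ∈ numericalRange A := by
  rw [mem_numericalRange_iff_mem_bild, bild_slice hm _ (by positivity)] at *
  simpa using convex_bild A h₁ h₂ hs ht hst

theorem slice_combo (m : ℍ) (α₁ α₂ β₁ β₂ s t : ℝ) :
    s • ((α₁ : ℍ) + m * (β₁ : ℍ)) + t • ((α₂ : ℍ) + m * (β₂ : ℍ)) =
      ((s * α₁ + t * α₂ : ℝ) : ℍ) + m * ((s * β₁ + t * β₂ : ℝ) : ℍ) := by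
  ext <;> simp <;> ring

theorem I_mem_imaginaryUnits : ((Complex.I : ℂ) : ℍ) ∈ imaginaryUnits := by
  exact ⟨by ext <;> simp, norm_coeComplex_I⟩

theorem coe_eq_slice (z : ℂ) :
    (z : ℍ) = (z.re : ℍ) + ((Complex.I : ℂ) : ℍ) * (z.im : ℍ) := by
  ext <;> simp

end QuatRange

theorem mainTheorem1 (n : ℕ) (A : Matrix (Fin n) (Fin n) ℍ) :
    (∀ m ∈ QuatRange.imaginaryUnits,
      Convex ℝ (QuatRange.numericalRange A ∩ QuatRange.closedUpperSlice m) ∧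
      Convex ℝ (QuatRange.numericalRange A ∩ QuatRange.openUpperSlice m)) ∧
    Convex ℝ (QuatRange.complexSection A) := by
  refine ⟨fun m hm => ⟨?_, ?_⟩, ?_⟩
  · rintro _ ⟨h₁, α₁, β₁, hβ₁, rfl⟩ _ ⟨h₂, α₂, β₂, hβ₂, rfl⟩ s t hs ht hst
    rw [QuatRange.slice_combo]
    exact ⟨QuatRange.slice_mem A hm hβ₁ hβ₂ hs ht hst h₁ h₂, _, _, by positivity, rfl⟩
  · rintro _ ⟨h₁, α₁, β₁, hβ₁, rfl⟩ _ ⟨h₂, α₂, β₂, hβ₂, rfl⟩ s t hs ht hst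
    rw [QuatRange.slice_combo]
    exact ⟨QuatRange.slice_mem A hm hβ₁.le hβ₂.le hs ht hst h₁ h₂, _, _,
      convex_Ioi (0 : ℝ) hβ₁ hβ₂ hs ht hst, rfl⟩
  · rintro z ⟨h₁, hβ₁⟩ w ⟨h₂, hβ₂⟩ s t hs ht hst
    rw [QuatRange.coe_eq_slice] at h₁ h₂
    have h := QuatRange.slice_mem A QuatRange.I_mem_imaginaryUnits hβ₁ hβ₂ hs ht hst h₁ h₂
    refine ⟨?_, ?_⟩
    · rw [QuatRange.coe_eq_slice]
      simpa using h
    · simp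
      positivity
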